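/- Let $N\ge 0$, $k\ge 1$ be integers, and let $$s(z,y)=y^k+\sum_{j=0}^{k-1}\varsigma_j(z)\,y^j,\qquad \varsigma_0,\dots,\varsigma_{k-1}\in\mathbb{C}[z_1,\dots,z_N],\quad z\in\mathbb{C}^N,\ y\in\mathbb{C},$$ be a polynomial of total degree $d$ (so $d\ge k$). Put $V(s)=\{(z,y)\in\mathbb{C}^{N+1}: s(z,y)=0\}$ and let $\mathcal{A}(s)=\{z\in\mathbb{C}^N:\mathrm{Disc}_y(s)(z)=0\}$ be the zero set of the discriminant of $s$ with respect to $y$. For a polynomial $p$ and a set $S$ write $\|p\|_S=\sup_{x\in S}|p(x)|$. A sequence of sets $\{\mathcal{A}_n\}_{n\ge1}$ is called *weakly admissible meshes* on a compact set $K$ if each $\mathcal{A}_n$ is a finite subset of $K$ and there are constants $C_n>0$ such that $\|p\|_K\le C_n\|p\|_{\mathcal{A}_n}$ for all polynomials $p$ of total degree at most $n$, where $C_n$ and $\mathrm{card}\,\mathcal{A}_n$ are of polynomial growth in $n$ (bounded by $Mn^r$ for all $n\ge 1$, with $M,r$ independent of $n$). A compact set $K\subset\mathbb{C}^N$ *satisfies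 the division inequality* if there is an exponent $m>0$ such that for every polynomial $q\not\equiv0$ on $K$ there is a constant $M>0$ with $$\|p\|_K\le M(\deg p+\deg q)^{m\deg q}\,\|pq\|_K\qquad\text{for all polynomials }p$$ (with the convention $0^0=1$, and $\deg 0=0$). Let $K\subset\mathbb{C}^N$ be a compact set that satisfies the division inequality, let $\{\mathcal{A}_n\}_{n\ge1}$ be weakly admissible meshes on $K$, and let $z_0\in K\setminus\mathcal{A}(s)$. Then the set $E=\{(z,y)\in V(s): z\in K\}$ is compact, and the sets $$\mathcal{B}_n=\{(z,y)\in E: z\in\mathcal{A}_{\ell(n)}\cup\{z_0\}\},\qquad \ell(n)=\begin{cases}2(n+k^2-k)& \text{if } d=k,\\ 2dn&\text{if } d>k,\end{cases}\qquad n\ge1,$$ are weakly admissible meshes on $E$; in particular, there are constants $D_n$ of polynomial growth in $n$ such that $\|p\|_E\le D_n\|p\|_{\mathcal{B}_n}$ for every polynomial $p$ in $(z,y)$ of total degree at most $n$. -/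

import Mathlib

noncomputable section

/-- The uniform norm `‖p‖_S = sup_{x ∈ S} |p(x)|` of a polynomial on a set `S ⊆ ℂ^σ`.
It is used for compact sets and their finite subsets only; it is `0` on the empty set. -/
def supNorm {σ : Type*} (p : MvPolynomial σ ℂ) (S : Set (σ → ℂ)) : ℝ :=
  sSup ((fun x : σ → ℂ => ‖MvPolynomial.eval x p‖) '' S)

/-- A real sequence indexed by `n = 1, 2, …` is of polynomial growth in `n`. -/
def PolynomialGrowth (a : ℕ → ℝ) : Prop :=
  ∃ (M : ℝ) (r : ℕ), ∀ n : ℕ, 1 ≤ n → a n ≤ M * (n : ℝ) ^ r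

/-- The family `A 1, A 2, …` represents weakly admissible meshes on `K`: these are finite subsets
of `K`, with `‖p‖_K ≤ C n * ‖p‖_{A n}` for all polynomials `p` of total degree at most `n`, where
the constants `C n` and the cardinalities of `A n` are of polynomial growth in `n`. -/
structure IsWeaklyAdmissibleMesh {σ : Type*} (K : Set (σ → ℂ)) (A : ℕ → Set (σ → ℂ)) : Prop where
  subset : ∀ n : ℕ, 1 ≤ n → A n ⊆ K
  finite : ∀ n : ℕ, 1 ≤ n → (A n).Finite
  norming : ∃ C : ℕ → ℝ, PolynomialGrowth C ∧ ∀ n : ℕ, 1 ≤ n → 0 < C n ∧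
    ∀ p : MvPolynomial σ ℂ, p.totalDegree ≤ n → supNorm p K ≤ C n * supNorm p (A n)
  card_growth : PolynomialGrowth (fun n => ((A n).ncard : ℝ))

/-- `K` satisfies the division inequality with exponent `m`: for every polynomial `q` that does not
vanish identically on `K` there is a constant `M > 0` such that, for all polynomials `p`,
`‖p‖_K ≤ M (deg p + deg q) ^ (m deg q) ‖p q‖_K`. (Here `0 ^ 0 = 1`.) -/
def DivisionInequality {σ : Type*} (K : Set (σ → ℂ)) (m : ℝ) : Prop :=
  ∀ q : MvPolynomial σ ℂ, (∃ x ∈ K, MvPolynomial.eval x q ≠ 0) →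
    ∃ M : ℝ, 0 < M ∧ ∀ p : MvPolynomial σ ℂ,
      supNorm p K ≤
        M * ((p.totalDegree : ℝ) + (q.totalDegree : ℝ)) ^ (m * (q.totalDegree : ℝ)) *
          supNorm (p * q) K

/-- The polynomial `s(z, y) = y ^ k + ∑_{j < k} c_j(z) y ^ j` on `ℂ^{N+1}`; the last variable
is `y`. -/
def hypersurfacePoly {N k : ℕ} (c : Fin k → MvPolynomial (Fin N) ℂ) :
    MvPolynomial (Fin (N + 1)) ℂ :=
  MvPolynomial.X (Fin.last N) ^ k +
    ∑ j : Fin k, MvPolynomial.rename Fin.castSucc (c j) * MvPolynomial.X (Fin.last N) ^ (j : ℕ)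

/-- The same polynomial `s`, regarded as a polynomial in `y` over the ring `ℂ[z_1, …, z_N]`. -/
def hypersurfacePolyInY {N k : ℕ} (c : Fin k → MvPolynomial (Fin N) ℂ) :
    Polynomial (MvPolynomial (Fin N) ℂ) :=
  Polynomial.X ^ k + ∑ j : Fin k, Polynomial.C (c j) * Polynomial.X ^ (j : ℕ)

/-- The set `{z ∈ ℂ^N : Disc_y(s)(z) = 0}`. -/
def discriminantSet {N k : ℕ} (c : Fin k → MvPolynomial (Fin N) ℂ) : Set (Fin N → ℂ) :=
  {z | MvPolynomial.eval z (hypersurfacePolyInY c).discr = 0}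

/-- The part of the hypersurface `V(s)` above `K`, i.e. `{(z, y) : s(z, y) = 0, z ∈ K}`. -/
def liftSet {N k : ℕ} (c : Fin k → MvPolynomial (Fin N) ℂ) (K : Set (Fin N → ℂ)) :
    Set (Fin (N + 1) → ℂ) :=
  {x | MvPolynomial.eval x (hypersurfacePoly c) = 0 ∧ (fun i : Fin N => x i.castSucc) ∈ K}

/-- The index `ℓ(n)`, equal to `2 (n + k² - k)` if `d = k` and to `2 d n` otherwise. -/
def meshIndex (d k n : ℕ) : ℕ :=
  if d = k then 2 * (n + k ^ 2 - k) else 2 * d * n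

/-- The set `{(z, y) ∈ E : z ∈ A (ℓ(n)) ∪ {z₀}}`, where `E` is the part of `V(s)` above `K` and
`d` is the total degree of `s`. -/
def liftedMesh {N k : ℕ} (c : Fin k → MvPolynomial (Fin N) ℂ) (K : Set (Fin N → ℂ))
    (A : ℕ → Set (Fin N → ℂ)) (z₀ : Fin N → ℂ) (n : ℕ) : Set (Fin (N + 1) → ℂ) :=
  {x ∈ liftSet c K | (fun i : Fin N => x i.castSucc) ∈
    A (meshIndex (hypersurfacePoly c).totalDegree k n) ∪ {z₀}}

end

/-! Values of p over K are controlled by polynomials in z alone, to which the norming inequality on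
K applies. Two eliminations of y serve the two forms of the mesh index.

If d > k, fix x in E and put τ = p(x). The function F(z) = ∏ (p(z, yᵢ) - τ) - (-τ)^k, over the roots
yᵢ of s(z, ·), is a resultant minus a constant, so Bézout gives deg F ≤ dn. Below x the product
vanishes and |F| = |τ|^k. Over the mesh, where |p| ≤ m, every surviving term carries a factor p(z,
yᵢ), so |F| ≤ (|τ| + m)^k - |τ|^k. Norming and Bernoulli's inequality give |τ| ≤ (1 + C) k m
(`supNorm_liftSet_le_of_norming`).

If d = k, the remainder r of p modulo s still has total degree at most n. Freeze y = t at the last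
coordinate of x; then r(z, t) times the discriminant has degree at most n + k² - k. Lagrange
interpolation in the fibre bounds it over the mesh by a constant times m. Norming carries the bound
to K, and the division inequality removes the discriminant at polynomial cost, since its degree is
fixed (`supNorm_liftSet_le_of_division`). -/

/-! ### Total degree under division and resultants in y -/

/-- The polynomial `P = ∑ Pᵢ yⁱ` over `ℂ[z]` has total degree at most `n` in `(z, y)`. -/
def TotalDegreeLE {σ : Type*} (P : Polynomial (MvPolynomial σ ℂ)) (n : ℕ) : Prop :=
  ∀ i, P.coeff i ≠ 0 → (P.coeff i).totalDegree + i ≤ n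

namespace TotalDegreeLE

variable {σ : Type*} {P Q : Polynomial (MvPolynomial σ ℂ)} {n d e : ℕ}

lemma sub (hP : TotalDegreeLE P n) (hQ : TotalDegreeLE Q n) : TotalDegreeLE (P - Q) n := by
  intro i hi
  rw [Polynomial.coeff_sub] at hi ⊢
  by_cases h1 : P.coeff i = 0
  · rw [h1, zero_sub, neg_ne_zero] at hi
    rw [h1, zero_sub, MvPolynomial.totalDegree_neg]
    exact hQ i hi
  by_cases h2 : Q.coeff i = 0
  · rw [h2, sub_zero]
    exact hP i h1
  have h3 := MvPolynomial.totalDegree_sub (P.coeff i) (Q.coeff i)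
  have h4 := hP i h1
  have h5 := hQ i h2
  omega

lemma const (τ : ℂ) : TotalDegreeLE (Polynomial.C (MvPolynomial.C τ : MvPolynomial σ ℂ)) n := by
  intro i hi
  rcases Nat.eq_zero_or_pos i with rfl | h
  · simp
  · simp [Polynomial.coeff_C, h.ne'] at hi

lemma natDegree_le (hP : TotalDegreeLE P n) : P.natDegree ≤ n := by
  by_cases h : P = 0
  · simp [h]
  · have := hP P.natDegree (by simpa using h)
    omega

lemma derivative (hP : TotalDegreeLE P n) : TotalDegreeLE P.derivative (n - 1) := by
  intro i hi
  rw [Polynomial.coeff_derivative] at hi ⊢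
  have h1 := hP (i + 1) (left_ne_zero_of_mul hi)
  have h2 := MvPolynomial.totalDegree_mul (P.coeff (i + 1)) ((i : MvPolynomial σ ℂ) + 1)
  have h3 : ((i : MvPolynomial σ ℂ) + 1).totalDegree = 0 := by
    have : (i : MvPolynomial σ ℂ) + 1 = MvPolynomial.C ((i : ℂ) + 1) := by simp
    rw [this, MvPolynomial.totalDegree_C]
  omega

lemma mul_monomial {a : MvPolynomial σ ℂ} {b k : ℕ} (hP : TotalDegreeLE P k)
    (ha : a ≠ 0 → a.totalDegree + k + b ≤ n) :
    TotalDegreeLE (P * Polynomial.C a * Polynomial.X ^ b) n := by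
  intro i hi
  rw [Polynomial.coeff_mul_X_pow'] at hi ⊢
  split_ifs at hi ⊢ with h
  · rw [Polynomial.coeff_mul_C] at hi ⊢
    have h1 := hP _ (left_ne_zero_of_mul hi)
    have h2 := ha (right_ne_zero_of_mul hi)
    have h3 := MvPolynomial.totalDegree_mul (P.coeff (i - b)) a
    omega
  · exact absurd rfl hi

/-- Division by a monic polynomial whose total degree is its degree in `y` does not increase the
total degree of the remainder. -/
lemma modByMonic {S : Polynomial (MvPolynomial σ ℂ)} (hS : S.Monic)
    (hSd : TotalDegreeLE S S.natDegree) (hP : TotalDegreeLE P n) : TotalDegreeLE (P %ₘ S) n := by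
  -- Induction on b, where S.natDegree + b bounds the positions of nonzero coefficients: each step
  -- cancels the top one, possibly zero, by a multiple of S of total degree at most n.
  suffices H : ∀ b : ℕ, ∀ P : Polynomial (MvPolynomial σ ℂ), TotalDegreeLE P n →
      (∀ i, S.natDegree + b ≤ i → P.coeff i = 0) → TotalDegreeLE (P %ₘ S) n from
    H (P.natDegree + 1) P hP fun i hi => Polynomial.coeff_eq_zero_of_natDegree_lt (by omega)
  intro b
  induction b with
  | zero =>
    intro P hP h
    rwa [(Polynomial.modByMonic_eq_self_iff hS).2]
    rw [Polynomial.degree_eq_natDegree hS.ne_zero, Polynomial.degree_lt_iff_coeff_zero]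
    exact h
  | succ b ih =>
    intro P hP h
    set a := P.coeff (S.natDegree + b) with ha
    have h1 : P %ₘ S = (P - S * Polynomial.C a * Polynomial.X ^ b) %ₘ S := by
      rw [Polynomial.sub_modByMonic, mul_assoc, Polynomial.self_mul_modByMonic hS, sub_zero]
    rw [h1]
    refine ih _ (hP.sub (hSd.mul_monomial fun h0 => ?_)) fun i hi => ?_
    · have := hP _ h0
      rw [← ha] at this
      omega
    · rw [Polynomial.coeff_sub, Polynomial.coeff_mul_X_pow', if_pos (by omega),
        Polynomial.coeff_mul_C]
      rcases hi.eq_or_lt with rfl | hi'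
      · rw [Nat.add_sub_cancel, hS.coeff_natDegree, one_mul, ha, sub_self]
      · rw [h i (by omega), Polynomial.coeff_eq_zero_of_natDegree_lt (p := S) (by omega)]
        simp

lemma totalDegree_eval_C_le (hP : TotalDegreeLE P n) (t : ℂ) :
    (P.eval (MvPolynomial.C t)).totalDegree ≤ n := by
  rw [Polynomial.eval_eq_sum_range]
  refine MvPolynomial.totalDegree_finsetSum_le fun i _ => ?_
  by_cases h : P.coeff i = 0
  · simp [h]
  · have h1 := hP i h
    have h2 := MvPolynomial.totalDegree_mul (P.coeff i) (MvPolynomial.C t ^ i)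
    have h3 : (MvPolynomial.C t ^ i : MvPolynomial σ ℂ).totalDegree = 0 := by
      rw [← map_pow, MvPolynomial.totalDegree_C]
    omega

/-- Each column is a shifted coefficient list, so degree plus row index has a bound depending on the
column only. Summed along a permutation, this bounds every term of the determinant alike. -/
lemma totalDegree_sylvester_add_le (hP : TotalDegreeLE P d) (hQ : TotalDegreeLE Q e) {m n : ℕ}
    (i j : Fin (m + n)) (h : Polynomial.sylvester P Q m n i j ≠ 0) :
    (Polynomial.sylvester P Q m n i j).totalDegree + i ≤
      Fin.addCases (motive := fun _ => ℕ) (fun j₁ : Fin m => e + j₁) (fun j₂ : Fin n => d + j₂) j := by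
  induction j using Fin.addCases with
  | left j =>
    simp only [Polynomial.sylvester, Matrix.of_apply, Fin.addCases_left] at h ⊢
    split_ifs at h ⊢ with h'
    · have := hQ _ h
      rw [Set.mem_Icc] at h'
      omega
    · exact absurd rfl h
  | right j =>
    simp only [Polynomial.sylvester, Matrix.of_apply, Fin.addCases_right] at h ⊢
    split_ifs at h ⊢ with h'
    · have := hP _ h
      rw [Set.mem_Icc] at h'
      omega
    · exact absurd rfl h

/-- Bézout's bound for the degree of the resultant with respect to `y`. -/
lemma totalDegree_resultant_le (hP : TotalDegreeLE P d) (hQ : TotalDegreeLE Q e) (m n : ℕ) :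
    (Polynomial.resultant P Q m n).totalDegree ≤ m * e + n * d - m * n := by
  rw [Polynomial.resultant, Matrix.det_apply]
  refine MvPolynomial.totalDegree_finsetSum_le fun τ _ => ?_
  set M := Polynomial.sylvester P Q m n with hM
  have hsgn : ∀ a : MvPolynomial σ ℂ, (Equiv.Perm.sign τ • a).totalDegree = a.totalDegree := by
    intro a
    rcases Int.units_eq_one_or (Equiv.Perm.sign τ) with h | h <;> simp [h]
  rw [hsgn]
  by_cases h0 : ∏ i, M (τ i) i = 0
  · simp [h0]
  rw [← ne_eq, Finset.prod_ne_zero_iff] at h0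
  have h1 : ∑ j, ((M (τ j) j).totalDegree + (τ j : ℕ)) ≤ ∑ j, Fin.addCases (motive := fun _ => ℕ)
      (fun j₁ : Fin m => e + j₁) (fun j₂ : Fin n => d + j₂) j :=
    Finset.sum_le_sum fun j _ => totalDegree_sylvester_add_le hP hQ _ _ (h0 j (Finset.mem_univ j))
  -- The row indices sum to the same number for every permutation; splitting that sum in `h4`
  -- produces the term mn that Bézout's bound subtracts.
  have h2 : ∑ j, (τ j : ℕ) = ∑ j : Fin (m + n), (j : ℕ) :=
    Equiv.sum_comp τ (fun j : Fin (m + n) => (j : ℕ))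
  have h3 := MvPolynomial.totalDegree_finsetProd Finset.univ fun j => M (τ j) j
  have h4 : ∑ j : Fin (m + n), (j : ℕ) = ∑ j : Fin m, (j : ℕ) + (n * m + ∑ j : Fin n, (j : ℕ)) := by
    rw [Fin.sum_univ_add]
    simp [Finset.sum_add_distrib]
  have h5 : ∑ j : Fin (m + n), Fin.addCases (motive := fun _ => ℕ) (fun j₁ : Fin m => e + j₁)
      (fun j₂ : Fin n => d + j₂) j =
      (m * e + ∑ j : Fin m, (j : ℕ)) + (n * d + ∑ j : Fin n, (j : ℕ)) := by
    rw [Fin.sum_univ_add]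
    simp [Finset.sum_add_distrib]
  rw [Finset.sum_add_distrib, h2, h4, h5] at h1
  have := mul_comm m n
  omega

end TotalDegreeLE

/-! ### Splitting off the last variable -/

/-- A polynomial in `(z, y)` regarded as a polynomial in the last variable `y` over `ℂ[z]`. -/
noncomputable def toPolynomialInLast {N : ℕ} (p : MvPolynomial (Fin (N + 1)) ℂ) :
    Polynomial (MvPolynomial (Fin N) ℂ) :=
  MvPolynomial.finSuccEquiv ℂ N (MvPolynomial.rename (finRotate (N + 1)) p)

lemma totalDegreeLE_toPolynomialInLast {N n : ℕ} {p : MvPolynomial (Fin (N + 1)) ℂ}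
    (hp : p.totalDegree ≤ n) : TotalDegreeLE (toPolynomialInLast p) n := by
  intro i hi
  refine (MvPolynomial.totalDegree_coeff_finSuccEquiv_add_le _ i hi).trans (le_trans ?_ hp)
  exact MvPolynomial.totalDegree_rename_le _ _

lemma eval_toPolynomialInLast {N : ℕ} (p : MvPolynomial (Fin (N + 1)) ℂ) (x : Fin (N + 1) → ℂ) :
    ((toPolynomialInLast p).map (MvPolynomial.eval fun i : Fin N => x i.castSucc)).eval
      (x (Fin.last N)) = MvPolynomial.eval x p := by
  rw [toPolynomialInLast, ← MvPolynomial.eval_eq_eval_mv_eval', MvPolynomial.eval_rename]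
  congr 2
  funext i
  induction i using Fin.lastCases with
  | last => simp
  | cast i => simp [Fin.coeSucc_eq_succ]

lemma toPolynomialInLast_hypersurfacePoly {N k : ℕ} (c : Fin k → MvPolynomial (Fin N) ℂ) :
    toPolynomialInLast (hypersurfacePoly c) = hypersurfacePolyInY c := by
  -- `finSuccEquiv` splits off variable 0; the rotation moves y there and shifts each zᵢ up by one.
  have h : (finRotate (N + 1) : Fin (N + 1) → Fin (N + 1)) ∘ Fin.castSucc = Fin.succ := by
    funext i
    simp [Fin.coeSucc_eq_succ]
  have h2 : ∀ q : MvPolynomial (Fin N) ℂ,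
      MvPolynomial.finSuccEquiv ℂ N (MvPolynomial.rename Fin.succ q) = Polynomial.C q := by
    intro q
    induction q using MvPolynomial.induction_on with
    | C a => simp [MvPolynomial.finSuccEquiv_apply]
    | add p q hp hq => simp [hp, hq]
    | mul_X p i hp =>
      rw [map_mul, map_mul, hp, MvPolynomial.rename_X, MvPolynomial.finSuccEquiv_X_succ, map_mul]
  simp [toPolynomialInLast, hypersurfacePoly, hypersurfacePolyInY, MvPolynomial.rename_rename, h,
    h2, MvPolynomial.finSuccEquiv_X_zero]

/-! ### Sup norms and polynomial growth -/

section SupNorm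

variable {σ : Type*} {S T : Set (σ → ℂ)} {p : MvPolynomial σ ℂ}

lemma norm_eval_le_supNorm (hS : IsCompact S) (p : MvPolynomial σ ℂ) {x : σ → ℂ} (hx : x ∈ S) :
    ‖MvPolynomial.eval x p‖ ≤ supNorm p S :=
  le_csSup (hS.image (MvPolynomial.continuous_eval p).norm).bddAbove ⟨x, hx, rfl⟩

/-- Nonnegativity of a covers the empty set, where the supremum is 0 by convention. -/
lemma supNorm_le {a : ℝ} (ha : 0 ≤ a) (h : ∀ x ∈ S, ‖MvPolynomial.eval x p‖ ≤ a) :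
    supNorm p S ≤ a :=
  Real.sSup_le (by rintro _ ⟨x, hx, rfl⟩; exact h x hx) ha

lemma supNorm_nonneg (p : MvPolynomial σ ℂ) (S : Set (σ → ℂ)) : 0 ≤ supNorm p S :=
  Real.sSup_nonneg (by rintro _ ⟨x, _, rfl⟩; exact norm_nonneg _)

end SupNorm

lemma polynomialGrowth_iff {a : ℕ → ℝ} : PolynomialGrowth a ↔
    ∃ (M : ℝ) (r : ℕ), 0 ≤ M ∧ ∀ n : ℕ, 1 ≤ n → a n ≤ M * (n : ℝ) ^ r := by
  constructor
  · rintro ⟨M, r, h⟩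
    exact ⟨|M|, r, abs_nonneg M, fun n hn => (h n hn).trans <| by gcongr; exact le_abs_self M⟩
  · rintro ⟨M, r, _, h⟩
    exact ⟨M, r, h⟩

namespace PolynomialGrowth

variable {a b : ℕ → ℝ}

lemma const (M : ℝ) : PolynomialGrowth fun _ => M := ⟨M, 0, by simp⟩

lemma mono (hb : PolynomialGrowth b) (h : ∀ n, 1 ≤ n → a n ≤ b n) : PolynomialGrowth a := by
  obtain ⟨M, r, hM⟩ := hb
  exact ⟨M, r, fun n hn => (h n hn).trans (hM n hn)⟩

lemma add (ha : PolynomialGrowth a) (hb : PolynomialGrowth b) :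
    PolynomialGrowth fun n => a n + b n := by
  obtain ⟨M, r, hM, h⟩ := polynomialGrowth_iff.1 ha
  obtain ⟨M', r', hM', h'⟩ := polynomialGrowth_iff.1 hb
  refine ⟨M + M', max r r', fun n hn => ?_⟩
  have hn' : (1 : ℝ) ≤ n := by exact_mod_cast hn
  rw [add_mul]
  refine add_le_add ((h n hn).trans ?_) ((h' n hn).trans ?_)
  · gcongr
    exact le_max_left _ _
  · gcongr
    exact le_max_right _ _

lemma mul (ha : PolynomialGrowth a) (hb : PolynomialGrowth b) (hb0 : ∀ n, 1 ≤ n → 0 ≤ b n) :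
    PolynomialGrowth fun n => a n * b n := by
  obtain ⟨M, r, hM, h⟩ := polynomialGrowth_iff.1 ha
  obtain ⟨M', r', hM', h'⟩ := polynomialGrowth_iff.1 hb
  refine ⟨M * M', r + r', fun n hn => ?_⟩
  calc a n * b n ≤ (M * (n : ℝ) ^ r) * (M' * (n : ℝ) ^ r') :=
        mul_le_mul (h n hn) (h' n hn) (hb0 n hn) (by positivity)
    _ = M * M' * (n : ℝ) ^ (r + r') := by ring

lemma comp (ha : PolynomialGrowth a) {ℓ : ℕ → ℕ} {A : ℕ}
    (hℓ : ∀ n, 1 ≤ n → 1 ≤ ℓ n ∧ ℓ n ≤ A * n) : PolynomialGrowth fun n => a (ℓ n) := by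
  obtain ⟨M, r, hM, h⟩ := polynomialGrowth_iff.1 ha
  refine ⟨M * (A : ℝ) ^ r, r, fun n hn => (h _ (hℓ n hn).1).trans ?_⟩
  have : (ℓ n : ℝ) ≤ A * n := by exact_mod_cast (hℓ n hn).2
  rw [mul_assoc, ← mul_pow]
  gcongr

/-- Handles the factor contributed by the division inequality, with q the degree of the
discriminant. -/
lemma add_const_rpow {q : ℝ} (hq : 0 ≤ q) (e : ℝ) : PolynomialGrowth fun n => ((n : ℝ) + q) ^ e := by
  refine ⟨(1 + q) ^ ⌈e⌉₊, ⌈e⌉₊, fun n hn => ?_⟩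
  have hn' : (1 : ℝ) ≤ n := by exact_mod_cast hn
  calc ((n : ℝ) + q) ^ e ≤ ((n : ℝ) + q) ^ (⌈e⌉₊ : ℝ) :=
        Real.rpow_le_rpow_of_exponent_le (by linarith) (Nat.le_ceil e)
    _ = ((n : ℝ) + q) ^ ⌈e⌉₊ := Real.rpow_natCast _ _
    _ ≤ ((1 + q) * n) ^ ⌈e⌉₊ := by gcongr; nlinarith
    _ = _ := by rw [mul_pow]

end PolynomialGrowth

/-! ### Scalar estimates in a single fibre -/

/-- In the expanded product the only term without a factor a is the subtracted power; the others are
dominated by the matching terms of (t + m)^k, with k the number of factors. -/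
lemma norm_prod_sub_sub_neg_pow_le {t m : ℝ} {τ : ℂ} (hτ : ‖τ‖ = t) {s : Multiset ℂ}
    (hs : ∀ a ∈ s, ‖a‖ ≤ m) (hm : 0 ≤ m) :
    ‖(s.map fun a => a - τ).prod - (-τ) ^ s.card‖ ≤ (t + m) ^ s.card - t ^ s.card := by
  induction s using Multiset.induction with
  | empty => simp
  | cons a s ih =>
    have ih := ih fun b hb => hs b (Multiset.mem_cons_of_mem hb)
    have ha := hs a (Multiset.mem_cons_self a s)
    rw [Multiset.map_cons, Multiset.prod_cons, Multiset.card_cons]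
    set X := (s.map fun a => a - τ).prod
    have h : (a - τ) * X - (-τ) ^ (s.card + 1) =
        (a - τ) * (X - (-τ) ^ s.card) + a * (-τ) ^ s.card := by ring
    have h1 : ‖a - τ‖ ≤ t + m := (norm_sub_le _ _).trans (by linarith)
    have ht : 0 ≤ t := hτ ▸ norm_nonneg τ
    calc ‖(a - τ) * X - (-τ) ^ (s.card + 1)‖
        ≤ ‖a - τ‖ * ‖X - (-τ) ^ s.card‖ + ‖a‖ * t ^ s.card := by
          rw [h]
          refine (norm_add_le _ _).trans ?_
          rw [norm_mul, norm_mul, norm_pow, norm_neg, hτ]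
      _ ≤ (t + m) * ((t + m) ^ s.card - t ^ s.card) + m * t ^ s.card := by gcongr
      _ = _ := by ring

/-- With b = (t + m)^k, Bernoulli gives b - t^k ≤ u b for u = km/(t + m). The hypothesis gives b ≤
(1 + C)(b - t^k), hence 1 ≤ (1 + C) u. -/
lemma le_mul_of_pow_le_mul_pow_sub_pow {t m C : ℝ} (ht : 0 ≤ t) (hm : 0 ≤ m) (hC : 0 ≤ C) {k : ℕ}
    (hk : 1 ≤ k) (h : t ^ k ≤ C * ((t + m) ^ k - t ^ k)) : t ≤ (1 + C) * k * m := by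
  have hk' : (1 : ℝ) ≤ k := by exact_mod_cast hk
  rcases (add_nonneg ht hm).eq_or_lt with h0 | h0
  · have : t = 0 := by linarith
    rw [this]
    positivity
  have h1 := one_add_mul_le_pow (a := -(m / (t + m))) (by
    have : m / (t + m) ≤ 1 := (div_le_one h0).2 (by linarith)
    linarith) k
  have h2 : 1 + -(m / (t + m)) = t / (t + m) := by field_simp; ring
  rw [h2, div_pow, le_div_iff₀ (pow_pos h0 k)] at h1
  set b := (t + m) ^ k
  have hb : 0 < b := pow_pos h0 k
  set u := (k : ℝ) * (m / (t + m)) with hu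
  have h3 : (1 + k * -(m / (t + m))) * b = b - u * b := by rw [hu]; ring
  rw [h3] at h1
  have h4 : C * (b - t ^ k) ≤ C * (u * b) := by gcongr; linarith
  have h5 : b * 1 ≤ b * ((1 + C) * u) := by linarith
  have h6 := le_of_mul_le_mul_left h5 hb
  have h7 : (1 + C) * u = ((1 + C) * k * m) / (t + m) := by rw [hu]; ring
  rw [h7, le_div_iff₀ h0] at h6
  linarith

open Polynomial in
/-- Lagrange interpolation at the roots of a monic polynomial, with the denominators cleared: the
remainder `r` of a polynomial modulo `f` is controlled, after multiplication with the
discriminant, by its values at the roots. -/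
lemma norm_prod_derivative_mul_eval_le {f r : ℂ[X]} (hf : f.Monic) (hr : r.degree < f.natDegree)
    {m B : ℝ} (hm : 0 ≤ m) (hB : 0 ≤ B) (hroots : ∀ y ∈ f.roots, ‖r.eval y‖ ≤ m) {t : ℂ}
    (ht : ∀ y ∈ f.roots, ‖t - y‖ ≤ B) (hdist : ∀ y ∈ f.roots, ∀ y' ∈ f.roots, ‖y - y'‖ ≤ B) :
    ‖(f.roots.map f.derivative.eval).prod‖ * ‖r.eval t‖ ≤
      f.natDegree * (B ^ (f.natDegree - 1) * (B ^ (f.natDegree - 1)) ^ (f.natDegree - 1)) * m := by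
  classical
  set k := f.natDegree with hk
  have hcard : Multiset.card f.roots = k := (IsAlgClosed.splits f).natDegree_eq_card_roots.symm
  -- A multiple root makes the left side zero; otherwise all roots are simple and can serve as
  -- interpolation nodes.
  by_cases h0 : (f.roots.map f.derivative.eval).prod = 0
  · rw [h0, norm_zero, zero_mul]
    positivity
  have hne : ∀ y ∈ f.roots, f.derivative.eval y ≠ 0 := fun y hy h =>
    h0 (Multiset.prod_eq_zero (Multiset.mem_map.2 ⟨y, hy, h⟩))
  have hnodup : f.roots.Nodup := by
    rw [Multiset.nodup_iff_count_le_one]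
    intro y
    by_contra! h
    have hy : y ∈ f.roots := Multiset.count_pos.1 (by omega)
    rw [count_roots, one_lt_rootMultiplicity_iff_isRoot hf.ne_zero] at h
    exact hne y hy h.2
  set s : Finset ℂ := ⟨f.roots, hnodup⟩ with hs
  have hscard : s.card = k := hcard
  have hnodal : f = Lagrange.nodal s id := by
    rw [Lagrange.nodal]
    conv_lhs => rw [(IsAlgClosed.splits f).eq_prod_roots_of_monic hf]
    rfl
  have hprod : (f.roots.map f.derivative.eval).prod = ∏ y ∈ s, f.derivative.eval y := rfl
  have hder : ∀ y ∈ s, f.derivative.eval y = ∏ y' ∈ s.erase y, (y - y') := by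
    intro y hy
    have := Lagrange.eval_nodal_derivative_eval_node_eq (v := id) hy
    rw [← hnodal, Lagrange.eval_nodal] at this
    exact this
  have hbound : ∀ y ∈ s, ∀ {A : ℝ} (g : ℂ → ℂ), (∀ y' ∈ s.erase y, ‖g y'‖ ≤ A) →
      ∏ y' ∈ s.erase y, ‖g y'‖ ≤ A ^ (k - 1) := by
    intro y hy A g hg
    refine (Finset.prod_le_prod (fun _ _ => norm_nonneg _) hg).trans_eq ?_
    rw [Finset.prod_const, Finset.card_erase_of_mem hy, hscard]
  have hderB : ∀ y ∈ s, ‖f.derivative.eval y‖ ≤ B ^ (k - 1) := by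
    intro y hy
    rw [hder y hy, norm_prod]
    exact hbound y hy _ fun y' hy' => hdist y hy y' (Finset.mem_of_mem_erase hy')
  have hlag : r.eval t = ∑ y ∈ s, r.eval y * ∏ y' ∈ s.erase y, ((t - y') / (y - y')) := by
    have h1 := Lagrange.eq_interpolate (s := s) (v := id) (f := r) (Set.injOn_id _)
      (by rw [hscard]; exact hr)
    conv_lhs => rw [h1]
    rw [Lagrange.interpolate_apply, eval_finsetSum]
    refine Finset.sum_congr rfl fun y hy => ?_
    rw [eval_mul, eval_C, Lagrange.basis, eval_prod]
    congr 1
    refine Finset.prod_congr rfl fun y' _ => ?_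
    simp [Lagrange.basisDivisor, div_eq_inv_mul]
  have hterm : ∀ y ∈ s, ‖(∏ y ∈ s, f.derivative.eval y) *
      (r.eval y * ∏ y' ∈ s.erase y, ((t - y') / (y - y')))‖ ≤
      (B ^ (k - 1) * (B ^ (k - 1)) ^ (k - 1)) * m := by
    intro y hy
    -- The factor f'(y) of the product is exactly the Lagrange denominator at y and cancels it.
    have h1 : (∏ y ∈ s, f.derivative.eval y) *
        (r.eval y * ∏ y' ∈ s.erase y, ((t - y') / (y - y'))) =
        (∏ y' ∈ s.erase y, (t - y')) * (∏ y' ∈ s.erase y, f.derivative.eval y') * r.eval y := by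
      rw [← Finset.mul_prod_erase s _ hy, Finset.prod_div_distrib, ← hder y hy]
      field_simp [hne y hy]
    rw [h1, norm_mul, norm_mul, norm_prod, norm_prod]
    gcongr
    · exact hbound y hy _ fun y' hy' => ht y' (Finset.mem_of_mem_erase hy')
    · exact hbound y hy _ fun y' hy' => hderB y' (Finset.mem_of_mem_erase hy')
    · exact hroots y hy
  rw [← norm_mul, hprod, hlag, Finset.mul_sum]
  refine (norm_sum_le _ _).trans ((Finset.sum_le_sum hterm).trans_eq ?_)
  rw [Finset.sum_const, hscard, nsmul_eq_mul, ← mul_assoc]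

/-! ### Fibres of the hypersurface over K -/

section Fibres

variable {N k : ℕ} (c : Fin k → MvPolynomial (Fin N) ℂ)

lemma degree_sum_C_mul_X_pow_lt {R : Type*} [CommRing R] (a : Fin k → R) :
    (∑ j : Fin k, Polynomial.C (a j) * Polynomial.X ^ (j : ℕ)).degree < (k : WithBot ℕ) := by
  rw [Polynomial.degree_lt_iff_coeff_zero]
  intro m hm
  rw [Polynomial.finsetSum_coeff]
  refine Finset.sum_eq_zero fun j _ => ?_
  rw [Polynomial.coeff_C_mul_X_pow, if_neg (by omega)]

lemma monic_hypersurfacePolyInY : (hypersurfacePolyInY c).Monic :=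
  Polynomial.monic_X_pow_add (degree_sum_C_mul_X_pow_lt c)

lemma natDegree_hypersurfacePolyInY : (hypersurfacePolyInY c).natDegree = k := by
  have h := degree_sum_C_mul_X_pow_lt c
  rw [← Polynomial.degree_X_pow (R := MvPolynomial (Fin N) ℂ) k] at h
  rw [hypersurfacePolyInY, Polynomial.natDegree_add_eq_left_of_degree_lt h,
    Polynomial.natDegree_X_pow]

/-- The polynomial `s(z, ·)`. -/
noncomputable def fibrePoly (z : Fin N → ℂ) : Polynomial ℂ :=
  (hypersurfacePolyInY c).map (MvPolynomial.eval z)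

lemma monic_fibrePoly (z : Fin N → ℂ) : (fibrePoly c z).Monic :=
  (monic_hypersurfacePolyInY c).map _

lemma natDegree_fibrePoly (z : Fin N → ℂ) : (fibrePoly c z).natDegree = k := by
  rw [fibrePoly, (monic_hypersurfacePolyInY c).natDegree_map, natDegree_hypersurfacePolyInY]

lemma card_roots_fibrePoly (z : Fin N → ℂ) : Multiset.card (fibrePoly c z).roots = k := by
  rw [← (IsAlgClosed.splits _).natDegree_eq_card_roots, natDegree_fibrePoly]

lemma mem_roots_fibrePoly {z : Fin N → ℂ} {y : ℂ} :
    y ∈ (fibrePoly c z).roots ↔ (fibrePoly c z).eval y = 0 :=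
  Polynomial.mem_roots (monic_fibrePoly c z).ne_zero

lemma mem_liftSet {K : Set (Fin N → ℂ)} {x : Fin (N + 1) → ℂ} : x ∈ liftSet c K ↔
    x (Fin.last N) ∈ (fibrePoly c fun i => x i.castSucc).roots ∧
      (fun i : Fin N => x i.castSucc) ∈ K := by
  rw [mem_roots_fibrePoly, fibrePoly, ← toPolynomialInLast_hypersurfacePoly,
    eval_toPolynomialInLast]
  rfl

lemma snoc_mem_liftedMesh {K : Set (Fin N → ℂ)} {A : ℕ → Set (Fin N → ℂ)} {z₀ z : Fin N → ℂ}
    {n : ℕ} {y : ℂ} (hzK : z ∈ K)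
    (hz : z ∈ A (meshIndex (hypersurfacePoly c).totalDegree k n))
    (hy : y ∈ (fibrePoly c z).roots) :
    (Fin.snoc z y : Fin (N + 1) → ℂ) ∈ liftedMesh c K A z₀ n := by
  refine ⟨(mem_liftSet c).2 ?_, ?_⟩
  · simp only [Fin.snoc_last, Fin.snoc_castSucc]
    exact ⟨hy, hzK⟩
  · simpa using Or.inr hz

lemma eval_snoc (p : MvPolynomial (Fin (N + 1)) ℂ) (z : Fin N → ℂ) (y : ℂ) :
    MvPolynomial.eval (Fin.snoc z y : Fin (N + 1) → ℂ) p =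
      ((toPolynomialInLast p).map (MvPolynomial.eval z)).eval y := by
  rw [← eval_toPolynomialInLast]
  simp

/-- Cauchy's root bound: if |y| ≥ 1, then |y|^k is at most the sum of the coefficient norms times
|y|^(k-1). -/
lemma exists_bound_roots_fibrePoly {K : Set (Fin N → ℂ)} (hK : IsCompact K) :
    ∃ B : ℝ, 1 ≤ B ∧ ∀ z ∈ K, ∀ y ∈ (fibrePoly c z).roots, ‖y‖ ≤ B := by
  refine ⟨1 + ∑ j, supNorm (c j) K,
    le_add_of_nonneg_right (Finset.sum_nonneg fun j _ => supNorm_nonneg _ _), fun z hz y hy => ?_⟩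
  by_contra! h
  have hS : 0 ≤ ∑ j, supNorm (c j) K := Finset.sum_nonneg fun j _ => supNorm_nonneg _ _
  have hy1 : 1 ≤ ‖y‖ := by linarith
  rw [mem_roots_fibrePoly] at hy
  have hy2 : y ^ k = -∑ j : Fin k, MvPolynomial.eval z (c j) * y ^ (j : ℕ) := by
    rw [eq_neg_iff_add_eq_zero, ← hy]
    simp [fibrePoly, hypersurfacePolyInY, Polynomial.eval_finsetSum, Polynomial.map_sum]
  have h1 : ‖y‖ ^ k ≤ (∑ j, supNorm (c j) K) * ‖y‖ ^ (k - 1) := by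
    rw [← norm_pow, hy2, norm_neg, Finset.sum_mul]
    refine (norm_sum_le _ _).trans (Finset.sum_le_sum fun j _ => ?_)
    rw [norm_mul, norm_pow]
    have h2 := norm_eval_le_supNorm hK (c j) hz
    gcongr
    · exact supNorm_nonneg _ _
    · omega
  rcases Nat.eq_zero_or_pos k with rfl | hk
  · simp at hy2
  · have h3 : ‖y‖ ^ k = ‖y‖ * ‖y‖ ^ (k - 1) := by
      rw [← pow_succ', Nat.sub_add_cancel hk]
    rw [h3] at h1
    have := le_of_mul_le_mul_right h1 (by positivity)
    linarith

lemma isCompact_liftSet {K : Set (Fin N → ℂ)} (hK : IsCompact K) : IsCompact (liftSet c K) := by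
  obtain ⟨B, hB, hroots⟩ := exists_bound_roots_fibrePoly c hK
  obtain ⟨B', hB'⟩ := hK.isBounded.exists_norm_le
  refine Metric.isCompact_of_isClosed_isBounded ?_ ?_
  · exact (isClosed_eq (MvPolynomial.continuous_eval _) continuous_const).inter
      (hK.isClosed.preimage (by fun_prop))
  · refine isBounded_iff_forall_norm_le.2 ⟨max B B', fun x hx => ?_⟩
    rw [mem_liftSet] at hx
    refine (pi_norm_le_iff_of_nonneg (le_max_of_le_left (by linarith))).2 fun i => ?_
    induction i using Fin.lastCases with
    | last => exact le_max_of_le_left (hroots _ hx.2 _ hx.1)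
    | cast i =>
      exact le_max_of_le_right
        ((norm_le_pi_norm (fun i : Fin N => x i.castSucc) i).trans (hB' _ hx.2))

lemma finite_liftedMesh_and_ncard_le {K : Set (Fin N → ℂ)} {A : ℕ → Set (Fin N → ℂ)}
    (z₀ : Fin N → ℂ) {n : ℕ}
    (hA : (A (meshIndex (hypersurfacePoly c).totalDegree k n)).Finite) :
    (liftedMesh c K A z₀ n).Finite ∧ (liftedMesh c K A z₀ n).ncard ≤
      ((A (meshIndex (hypersurfacePoly c).totalDegree k n)).ncard + 1) * k := by
  classical
  set T := A (meshIndex (hypersurfacePoly c).totalDegree k n)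
  have hT : (T ∪ {z₀}).Finite := hA.union (Set.finite_singleton z₀)
  set F : Finset (Fin (N + 1) → ℂ) := hT.toFinset.biUnion fun z =>
    (fibrePoly c z).roots.toFinset.image fun y => (Fin.snoc z y : Fin (N + 1) → ℂ) with hF
  have hsub : liftedMesh c K A z₀ n ⊆ F := by
    intro x hx
    rw [hF, Finset.mem_coe, Finset.mem_biUnion]
    refine ⟨_, hT.mem_toFinset.2 hx.2, Finset.mem_image.2 ⟨x (Fin.last N), ?_, ?_⟩⟩
    · exact Multiset.mem_toFinset.2 ((mem_liftSet c).1 hx.1).1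
    · exact Fin.snoc_init_self x
  refine ⟨F.finite_toSet.subset hsub, ?_⟩
  have h1 : F.card ≤ hT.toFinset.card * k := by
    refine Finset.card_biUnion_le_card_mul _ _ _ fun z _ => ?_
    refine Finset.card_image_le.trans ((Multiset.toFinset_card_le _).trans ?_)
    rw [card_roots_fibrePoly]
  have h2 : hT.toFinset.card ≤ T.ncard + 1 := by
    rw [← Set.ncard_eq_toFinset_card _ hT]
    refine (Set.ncard_union_le _ _).trans ?_
    rw [Set.ncard_singleton]
  calc (liftedMesh c K A z₀ n).ncard ≤ (F : Set (Fin (N + 1) → ℂ)).ncard :=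
        Set.ncard_le_ncard hsub F.finite_toSet
    _ = F.card := Set.ncard_coe_finset F
    _ ≤ _ := h1.trans (Nat.mul_le_mul_right k h2)

end Fibres

/-- The linear upper bound preserves polynomial growth under reindexing; the lower bound is needed
because the meshes are only controlled from index 1 on. -/
lemma meshIndex_bounds {d k : ℕ} (hk : 1 ≤ k) (hd : k ≤ d) (n : ℕ) (hn : 1 ≤ n) :
    1 ≤ meshIndex d k n ∧ meshIndex d k n ≤ (2 * (1 + k ^ 2) + 2 * d) * n := by
  have h1 : k ≤ k ^ 2 := Nat.le_self_pow two_ne_zero k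
  rw [meshIndex]
  split_ifs
  · refine ⟨by omega, ?_⟩
    have : k ^ 2 ≤ k ^ 2 * n := Nat.le_mul_of_pos_right _ hn
    nlinarith [Nat.sub_le (n + k ^ 2) k, Nat.zero_le (d * n)]
  · exact ⟨Nat.mul_pos (by omega) hn, by nlinarith⟩

/-! ### The two norming estimates on the lifted set -/

section Bounds

variable {N k : ℕ} {c : Fin k → MvPolynomial (Fin N) ℂ} {K : Set (Fin N → ℂ)}

/-- Bound for the values above `K` through the characteristic polynomial of `p` over `ℂ[z]`. -/
lemma supNorm_liftSet_le_of_norming (hk : 1 ≤ k) (hK : IsCompact K) {n : ℕ}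
    {T : Set (Fin N → ℂ)} {C : ℝ} (hC : 0 ≤ C)
    (hT : ∀ q : MvPolynomial (Fin N) ℂ, q.totalDegree ≤ (hypersurfacePoly c).totalDegree * n →
      supNorm q K ≤ C * supNorm q T)
    {p : MvPolynomial (Fin (N + 1)) ℂ} (hp : p.totalDegree ≤ n) {m : ℝ} (hm : 0 ≤ m)
    (hpm : ∀ z ∈ T, ∀ y ∈ (fibrePoly c z).roots,
      ‖MvPolynomial.eval (Fin.snoc z y : Fin (N + 1) → ℂ) p‖ ≤ m) :
    supNorm p (liftSet c K) ≤ (1 + C) * k * m := by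
  refine supNorm_le (by positivity) fun x hx => ?_
  set τ := MvPolynomial.eval x p with hτ
  refine le_mul_of_pow_le_mul_pow_sub_pow (norm_nonneg τ) hm hC hk ?_
  set P := toPolynomialInLast p with hP
  have hPd : TotalDegreeLE P n := totalDegreeLE_toPolynomialInLast hp
  have hSd : TotalDegreeLE (hypersurfacePolyInY c) (hypersurfacePoly c).totalDegree := by
    rw [← toPolynomialInLast_hypersurfacePoly]
    exact totalDegreeLE_toPolynomialInLast le_rfl
  set G := P - Polynomial.C (MvPolynomial.C τ) with hG
  have hGd : TotalDegreeLE G n := hPd.sub (TotalDegreeLE.const τ)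
  -- Removing the constant (-τ)^k leaves a polynomial small where p is small, yet of modulus |τ|^k
  -- below x, where one factor of the product vanishes.
  set F := Polynomial.resultant (hypersurfacePolyInY c) G k n - MvPolynomial.C ((-τ) ^ k) with hF
  have hFd : F.totalDegree ≤ (hypersurfacePoly c).totalDegree * n := by
    refine (MvPolynomial.totalDegree_sub _ _).trans (max_le ?_ (by rw [MvPolynomial.totalDegree_C]; exact zero_le))
    refine (hSd.totalDegree_resultant_le hGd k n).trans ?_
    rw [Nat.add_sub_cancel_left, mul_comm]
  have hGz : ∀ z y, (G.map (MvPolynomial.eval z)).eval y =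
      MvPolynomial.eval (Fin.snoc z y : Fin (N + 1) → ℂ) p - τ := by
    intro z y
    simp [eval_snoc, hG, hP]
  have hFz : ∀ z, MvPolynomial.eval z F = (((fibrePoly c z).roots.map fun y =>
      MvPolynomial.eval (Fin.snoc z y : Fin (N + 1) → ℂ) p).map fun a => a - τ).prod -
        (-τ) ^ k := by
    intro z
    have h := Polynomial.resultant_eq_prod_eval (fibrePoly c z) (G.map (MvPolynomial.eval z)) n
      (Polynomial.natDegree_map_le.trans hGd.natDegree_le) (IsAlgClosed.splits _)
    rw [natDegree_fibrePoly, (monic_fibrePoly c z).leadingCoeff, one_pow, one_mul, fibrePoly,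
      Polynomial.resultant_map_map] at h
    rw [hF, map_sub, h, MvPolynomial.eval_C, Multiset.map_map]
    congr 3
    funext y
    exact hGz z y
  have h1 : ‖τ‖ ^ k ≤ supNorm F K := by
    rw [mem_liftSet] at hx
    refine le_trans (le_of_eq ?_) (norm_eval_le_supNorm hK F hx.2)
    rw [hFz, Multiset.prod_eq_zero, zero_sub, norm_neg, norm_pow, norm_neg]
    rw [Multiset.map_map, Multiset.mem_map]
    refine ⟨_, hx.1, ?_⟩
    have : (Fin.snoc (fun i : Fin N => x i.castSucc) (x (Fin.last N)) : Fin (N + 1) → ℂ) = x :=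
      Fin.snoc_init_self x
    simp [this, hτ]
  have h2 : supNorm F T ≤ (‖τ‖ + m) ^ k - ‖τ‖ ^ k := by
    refine supNorm_le ?_ fun z hz => ?_
    · rw [sub_nonneg]
      gcongr
      linarith
    · have h := norm_prod_sub_sub_neg_pow_le (τ := τ) rfl (m := m)
        (s := (fibrePoly c z).roots.map fun y =>
          MvPolynomial.eval (Fin.snoc z y : Fin (N + 1) → ℂ) p) (by
          intro a ha
          obtain ⟨y, hy, rfl⟩ := Multiset.mem_map.1 ha
          exact hpm z hz y hy) hm
      rw [Multiset.card_map, card_roots_fibrePoly] at h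
      rw [hFz]
      exact h
  exact h1.trans ((hT F hFd).trans (mul_le_mul_of_nonneg_left h2 hC))

/-- The discriminant up to sign, as the resultant of `s` and `∂s/∂y`. -/
noncomputable def derivResultant (c : Fin k → MvPolynomial (Fin N) ℂ) : MvPolynomial (Fin N) ℂ :=
  Polynomial.resultant (hypersurfacePolyInY c) (hypersurfacePolyInY c).derivative k (k - 1)

lemma eval_derivResultant_ne_zero (hk : 1 ≤ k) {z : Fin N → ℂ} (hz : z ∉ discriminantSet c) :
    MvPolynomial.eval z (derivResultant c) ≠ 0 := by
  have h := Polynomial.resultant_deriv (f := hypersurfacePolyInY c) (by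
    rw [← Polynomial.natDegree_pos_iff_degree_pos, natDegree_hypersurfacePolyInY]
    exact hk)
  rw [natDegree_hypersurfacePolyInY, (monic_hypersurfacePolyInY c).leadingCoeff, mul_one] at h
  rw [derivResultant, h, map_mul, map_pow, map_neg, map_one]
  exact mul_ne_zero (pow_ne_zero _ (by norm_num)) hz

lemma eval_derivResultant (z : Fin N → ℂ) : MvPolynomial.eval z (derivResultant c) =
    ((fibrePoly c z).roots.map (fibrePoly c z).derivative.eval).prod := by
  have h := Polynomial.resultant_eq_prod_eval (fibrePoly c z) (fibrePoly c z).derivative (k - 1)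
    ((Polynomial.natDegree_derivative_le _).trans_eq (by rw [natDegree_fibrePoly]))
    (IsAlgClosed.splits _)
  rw [natDegree_fibrePoly, (monic_fibrePoly c z).leadingCoeff, one_pow, one_mul] at h
  rw [← h, derivResultant, fibrePoly, Polynomial.derivative_map, Polynomial.resultant_map_map]

/-- Bound for the values above `K` through the remainder of `p` modulo `s`, when the total degree
of `s` is its degree in `y`. -/
lemma supNorm_liftSet_le_of_division (hd : (hypersurfacePoly c).totalDegree = k)
    (hK : IsCompact K) {B : ℝ} (hB0 : 0 ≤ B)
    (hB : ∀ z ∈ K, ∀ y ∈ (fibrePoly c z).roots, ‖y‖ ≤ B)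
    {n : ℕ} {T : Set (Fin N → ℂ)} (hTK : T ⊆ K) {C D : ℝ} (hC : 0 ≤ C) (hD : 0 ≤ D)
    (hT : ∀ q : MvPolynomial (Fin N) ℂ, q.totalDegree ≤ n + (k ^ 2 - k) →
      supNorm q K ≤ C * supNorm q T)
    (hdiv : ∀ h : MvPolynomial (Fin N) ℂ, h.totalDegree ≤ n →
      supNorm h K ≤ D * supNorm (h * derivResultant c) K)
    {p : MvPolynomial (Fin (N + 1)) ℂ} (hp : p.totalDegree ≤ n) {m : ℝ} (hm : 0 ≤ m)
    (hpm : ∀ z ∈ T, ∀ y ∈ (fibrePoly c z).roots,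
      ‖MvPolynomial.eval (Fin.snoc z y : Fin (N + 1) → ℂ) p‖ ≤ m) :
    supNorm p (liftSet c K) ≤
      D * (C * (k * ((2 * B) ^ (k - 1) * ((2 * B) ^ (k - 1)) ^ (k - 1)))) * m := by
  refine supNorm_le (by positivity) fun x hx => ?_
  rw [mem_liftSet] at hx
  set S := hypersurfacePolyInY c with hS
  have hSm : S.Monic := monic_hypersurfacePolyInY c
  have hSk : S.natDegree = k := natDegree_hypersurfacePolyInY c
  have hSd : TotalDegreeLE S k := by
    rw [hS, ← toPolynomialInLast_hypersurfacePoly]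
    exact totalDegreeLE_toPolynomialInLast hd.le
  set P := toPolynomialInLast p with hP
  set r := P %ₘ S with hr
  have hrd : TotalDegreeLE r n :=
    TotalDegreeLE.modByMonic hSm (by rwa [hSk]) (totalDegreeLE_toPolynomialInLast hp)
  -- With y frozen at the last coordinate of x, h depends on z only and still equals p(x) below x.
  set h := r.eval (MvPolynomial.C (x (Fin.last N))) with hh
  have hhd : h.totalDegree ≤ n := hrd.totalDegree_eval_C_le _
  have hqd : (derivResultant c).totalDegree ≤ k ^ 2 - k := by
    refine (hSd.totalDegree_resultant_le hSd.derivative k (k - 1)).trans ?_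
    rw [Nat.add_sub_cancel_left, Nat.sub_mul, one_mul, sq]
  have hhz : ∀ z, MvPolynomial.eval z h =
      (r.map (MvPolynomial.eval z)).eval (x (Fin.last N)) := by
    intro z
    rw [hh, Polynomial.eval_map, Polynomial.eval, Polynomial.hom_eval₂]
    simp
  have hrz : ∀ z, ∀ y ∈ (fibrePoly c z).roots, (r.map (MvPolynomial.eval z)).eval y =
      MvPolynomial.eval (Fin.snoc z y : Fin (N + 1) → ℂ) p := by
    intro z y hy
    rw [mem_roots_fibrePoly, fibrePoly] at hy
    rw [eval_snoc, ← hP, ← Polynomial.modByMonic_add_div P S, Polynomial.map_add,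
      Polynomial.map_mul, Polynomial.eval_add, Polynomial.eval_mul, hy, zero_mul, add_zero]
  have h1 : ‖MvPolynomial.eval x p‖ ≤ supNorm h K := by
    refine le_trans (le_of_eq ?_) (norm_eval_le_supNorm hK h hx.2)
    have : (Fin.snoc (fun i : Fin N => x i.castSucc) (x (Fin.last N)) : Fin (N + 1) → ℂ) = x :=
      Fin.snoc_init_self x
    rw [hhz, hrz _ _ hx.1, this]
  have h2 : supNorm (h * derivResultant c) T ≤
      k * ((2 * B) ^ (k - 1) * ((2 * B) ^ (k - 1)) ^ (k - 1)) * m := by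
    refine supNorm_le (by positivity) fun z hz => ?_
    -- The frozen y is itself a root over a point of K, so its distance to any root over K, like the
    -- distance between two such roots, is at most 2B.
    have hlag := norm_prod_derivative_mul_eval_le (f := fibrePoly c z)
      (r := r.map (MvPolynomial.eval z)) (monic_fibrePoly c z) (B := 2 * B) (m := m)
      (t := x (Fin.last N)) ?_ hm (by positivity) ?_ ?_ ?_
    · rw [natDegree_fibrePoly] at hlag
      rw [map_mul, norm_mul, mul_comm, eval_derivResultant, hhz]
      exact hlag
    · rw [natDegree_fibrePoly]
      refine Polynomial.degree_map_le.trans_lt ?_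
      rw [← hSk, ← Polynomial.degree_eq_natDegree hSm.ne_zero]
      exact Polynomial.degree_modByMonic_lt P hSm
    · intro y hy
      rw [hrz z y hy]
      exact hpm z hz y hy
    · intro y hy
      have h3 := hB _ hx.2 _ hx.1
      have h4 := hB z (hTK hz) y hy
      exact (norm_sub_le _ _).trans (by linarith)
    · intro y hy y' hy'
      have h3 := hB z (hTK hz) y' hy'
      have h4 := hB z (hTK hz) y hy
      exact (norm_sub_le _ _).trans (by linarith)
  have h3 : supNorm (h * derivResultant c) K ≤ C * supNorm (h * derivResultant c) T :=
    hT _ ((MvPolynomial.totalDegree_mul _ _).trans (add_le_add hhd hqd))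
  calc ‖MvPolynomial.eval x p‖ ≤ D * supNorm (h * derivResultant c) K := h1.trans (hdiv h hhd)
    _ ≤ D * (C * (k * ((2 * B) ^ (k - 1) * ((2 * B) ^ (k - 1)) ^ (k - 1)) * m)) := by
      gcongr
      exact h3.trans (by gcongr)
    _ = _ := by ring

end Bounds

/-! ### Assembling the theorem -/

lemma le_totalDegree_hypersurfacePoly {N k : ℕ} (c : Fin k → MvPolynomial (Fin N) ℂ) :
    k ≤ (hypersurfacePoly c).totalDegree := by
  have h : TotalDegreeLE (hypersurfacePolyInY c) (hypersurfacePoly c).totalDegree := by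
    rw [← toPolynomialInLast_hypersurfacePoly]
    exact totalDegreeLE_toPolynomialInLast le_rfl
  exact (natDegree_hypersurfacePolyInY c).symm.le.trans h.natDegree_le

theorem mainTheorem1 {N k : ℕ} (hk : 1 ≤ k) (c : Fin k → MvPolynomial (Fin N) ℂ)
    (K : Set (Fin N → ℂ)) (hK : IsCompact K)
    (hdiv : ∃ m : ℝ, 0 < m ∧ DivisionInequality K m)
    (A : ℕ → Set (Fin N → ℂ)) (hA : IsWeaklyAdmissibleMesh K A)
    (z₀ : Fin N → ℂ) (hz₀ : z₀ ∈ K \ discriminantSet c) :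
    IsCompact (liftSet c K) ∧
      IsWeaklyAdmissibleMesh (liftSet c K) (liftedMesh c K A z₀) := by
  refine ⟨isCompact_liftSet c hK, ?_⟩
  set d := (hypersurfacePoly c).totalDegree with hd
  have hℓ := meshIndex_bounds hk (le_totalDegree_hypersurfacePoly c)
  rw [← hd] at hℓ
  have hfin := fun n hn => finite_liftedMesh_and_ncard_le (K := K) c z₀ (n := n)
    (hA.finite _ (hℓ n hn).1)
  have hmesh : ∀ n, 1 ≤ n → ∀ p : MvPolynomial (Fin (N + 1)) ℂ, ∀ z ∈ A (meshIndex d k n),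
      ∀ y ∈ (fibrePoly c z).roots, ‖MvPolynomial.eval (Fin.snoc z y : Fin (N + 1) → ℂ) p‖ ≤
        supNorm p (liftedMesh c K A z₀ n) := fun n hn p z hz y hy =>
    norm_eval_le_supNorm (hfin n hn).1.isCompact p
      (snoc_mem_liftedMesh c (hA.subset _ (hℓ n hn).1 hz) hz hy)
  obtain ⟨C, hCg, hC⟩ := hA.norming
  refine ⟨fun n _ x hx => hx.1, fun n hn => (hfin n hn).1, ?_, ?_⟩
  · have hCℓ := hCg.comp hℓ
    by_cases hdk : d = k
    · obtain ⟨e, he, hdiv⟩ := hdiv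
      -- The point z₀ witnesses that the discriminant does not vanish identically on K.
      obtain ⟨M, hM, hdiv⟩ := hdiv (derivResultant c)
        ⟨z₀, hz₀.1, eval_derivResultant_ne_zero hk hz₀.2⟩
      obtain ⟨B, hB1, hB⟩ := exists_bound_roots_fibrePoly c hK
      set q := (derivResultant c).totalDegree
      set D : ℕ → ℝ := fun n => M * ((n : ℝ) + q) ^ (e * q) with hD
      have hD0 : ∀ n, 1 ≤ n → 0 < D n := by
        intro n hn
        have : (1 : ℝ) ≤ n := by exact_mod_cast hn
        positivity
      have hDg : PolynomialGrowth D :=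
        (PolynomialGrowth.const M).mul (PolynomialGrowth.add_const_rpow (Nat.cast_nonneg q) _)
          fun n _ => by positivity
      have hG : 0 < (k : ℝ) * ((2 * B) ^ (k - 1) * ((2 * B) ^ (k - 1)) ^ (k - 1)) := by
        positivity
      set G := (k : ℝ) * ((2 * B) ^ (k - 1) * ((2 * B) ^ (k - 1)) ^ (k - 1))
      refine ⟨fun n => D n * (C (meshIndex d k n) * G), ?_, fun n hn => ⟨?_, fun p hp => ?_⟩⟩
      · refine hDg.mul (hCℓ.mul (PolynomialGrowth.const G) fun _ _ => hG.le) fun n hn => ?_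
        exact mul_nonneg (hC _ (hℓ n hn).1).1.le hG.le
      · exact mul_pos (hD0 n hn) (mul_pos (hC _ (hℓ n hn).1).1 hG)
      · refine supNorm_liftSet_le_of_division (hd.symm.trans hdk) hK (by linarith) hB
          (hA.subset _ (hℓ n hn).1) (hC _ (hℓ n hn).1).1.le (hD0 n hn).le
          (fun f hf => (hC _ (hℓ n hn).1).2 f (hf.trans ?_)) (fun h hh => (hdiv h).trans ?_) hp
          (supNorm_nonneg _ _) (hmesh n hn p)
        · have := Nat.le_self_pow two_ne_zero k
          rw [meshIndex, if_pos hdk]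
          omega
        · have := supNorm_nonneg (h * derivResultant c) K
          simp only [hD]
          gcongr
    · refine ⟨fun n => (1 + C (meshIndex d k n)) * k, ?_, fun n hn => ⟨?_, fun p hp => ?_⟩⟩
      · exact ((PolynomialGrowth.const 1).add hCℓ).mul (PolynomialGrowth.const k) fun _ _ => by
          positivity
      · have := (hC _ (hℓ n hn).1).1
        positivity
      · refine supNorm_liftSet_le_of_norming hk hK (hC _ (hℓ n hn).1).1.le
          (fun f hf => (hC _ (hℓ n hn).1).2 f (hf.trans ?_)) hp (supNorm_nonneg _ _)
          (hmesh n hn p)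
        -- Degree dn is enough here, half of the index used.
        rw [meshIndex, if_neg hdk, mul_assoc, ← hd]
        omega
  · refine (((hA.card_growth.comp hℓ).add (PolynomialGrowth.const 1)).mul
      (PolynomialGrowth.const k) fun _ _ => Nat.cast_nonneg k).mono fun n hn => ?_
    exact_mod_cast (hfin n hn).2
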